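/- **Setting.** A configuration $(G,\mathbf x)$ is a finite simple graph $G$ whose nodes have unique integer identities, with an input bit string $\mathbf x(v)$ at each node $v$. We write $(G',\mathbf x')\subseteq(G,\mathbf x)$ if $G'$ is a subgraph of $G$ and $\mathbf x'$ is the restriction of $\mathbf x$ to $V(G')$. A problem $\Pi$ is a collection of triplets $(G,\mathbf x,\mathbf y)$, with $\mathbf y$ an assignment of output bit strings to the nodes of $G$, that is closed under disjoint union. A family of instances $\mathcal F$ for $\Pi$ is a set of configurations that is closed under $\subseteq$ and such that for each $(G,\mathbf x)\in\mathcal F$ some $\mathbf y$ has $(G,\mathbf x,\mathbf y)\in\Pi$. A parameter $p:\mathcal F\to\mathbb N$ is non-decreasing if $p(G',\mathbf x')\le p(G,\mathbf x)$ whenever $(G',\mathbf x')\subseteq(G,\mathbf x)$. Algorithms are synchronous message-passing algorithms in the LOCAL model: all nodes start simultaneously, each knowing its own identity and input, messages and local computation are unrestricted, and a node terminates by writing its output. The running time is the number of rounds until all nodes have terminated. In a randomized algorithm each node also has its own independent fair random bits. A randomized algorithm is Las Vegas for $\Pi$ and $\mathcal F$ if on each $(G,\mathbf x)\in\mathcal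 F$ it terminates with an output $\mathbf y$ satisfying $(G,\mathbf x,\mathbf y)\in\Pi$ with probability $1$, and its expected running time is finite. Let $\Gamma=(p_1,\dots,p_\ell)$ be non-decreasing parameters. Guesses $\tilde p\in\mathbb N^\ell$ are good for $(G,\mathbf x)$ if $\tilde p_k\ge p_k(G,\mathbf x)$ for all $k$. A randomized algorithm $\mathcal A^\Gamma$ whose code uses a vector of guesses (the same at all nodes) is a weak Monte-Carlo algorithm with guarantee $\rho\in(0,1]$ depending on $\Gamma$, with running time bounded by $f:\mathbb N^\ell\to(0,\infty)$, if for each $(G,\mathbf x)\in\mathcal F$ and all good guesses $\tilde p$, with probability at least $\rho$ all nodes have terminated by some predetermined time $T\le f(\tilde p)$ with an output $\mathbf y$ such that $(G,\mathbf x,\mathbf y)\in\Pi$. (Otherwise it may fail, or never terminate.) A uniform algorithm uses no guesses. A function $s_f:\mathbb N\to\mathbb N$ is a sequence-number function for $f$ if (1) it is non-decreasing on the positive integers and there is a positive integer $\alpha$ with $s_f(2i)\le\alpha\, s_f(i)$ for all integers $i\ge2$; and (2) there are finite sets $S_f(i)\subseteq\mathbb N^\ell$ and a constant $c>0$ such that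 for all $i\ge1$: $|S_f(i)|\le s_f(i)$; $f(\underline x)\le c\, i$ for all $\underline x\in S_f(i)$; and each $\underline y\in\mathbb N^\ell$ with $f(\underline y)\le i$ is coordinate-wise at most some $\underline x\in S_f(i)$. A pruning algorithm $\mathcal P$ for $\Pi$ and $\mathcal F$ is a uniform deterministic local algorithm with constant running time that takes $(G,\mathbf x,\hat{\mathbf y})$, with $(G,\mathbf x)\in\mathcal F$ and $\hat{\mathbf y}$ any tentative output vector, and selects a set $W\subseteq V(G)$ of nodes to prune and new inputs $\mathbf x'$ for the other nodes, so that $\mathcal P(G,\mathbf x,\hat{\mathbf y}):=(G',\mathbf x')\in\mathcal F$, where $G'=G[V(G)\setminus W]$. It has to satisfy: solution detection, i.e. if $(G,\mathbf x,\hat{\mathbf y})\in\Pi$ then $W=V(G)$; and gluing, i.e. if $(G',\mathbf x',\mathbf y')\in\Pi$ then $(G,\mathbf x,\mathbf y)\in\Pi$, where $\mathbf y=\hat{\mathbf y}$ on $W$ and $\mathbf y=\mathbf y'$ on $V(G')$. It is $\Gamma$-monotone if $p_k(\mathcal P(G,\mathbf x,\hat{\mathbf y}))\le p_k(G,\mathbf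 x)$ for all $k$, all $(G,\mathbf x)\in\mathcal F$ and all $\hat{\mathbf y}$. **Theorem.** Let $\Pi$ be a problem, $\mathcal F$ a family of instances for $\Pi$, and $\mathcal A^\Gamma$ a weak Monte-Carlo algorithm for $\Pi$ and $\mathcal F$, with some guarantee $\rho\in(0,1]$, depending on a set $\Gamma$ of $\ell$ non-decreasing parameters. Suppose that its running time is bounded by a non-decreasing function $f:\mathbb N^\ell\to(0,\infty)$, that $s_f$ is a sequence-number function for $f$, and that there is a $\Gamma$-monotone pruning algorithm for $\Pi$ and $\mathcal F$. Then there is a uniform Las Vegas algorithm for $\Pi$ and $\mathcal F$ whose expected running time on each $(G,\mathbf x)\in\mathcal F$ is at most $K\cdot f^*\cdot s_f(\lceil f^*\rceil)$, where $f^*=f(p_1(G,\mathbf x),\dots,p_\ell(G,\mathbf x))$ and the constant $K$ does not depend on $(G,\mathbf x)$. -/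

import Mathlib

open MeasureTheory
open scoped ENNReal

/-- Finite bit strings. -/
abbrev Bits : Type := List Bool

/-! ### Configurations, problems, families of instances, parameters -/

/-- A configuration `(G, x)`: a finite simple graph (not necessarily connected) together with an
input bit string at every node. A node is named by its identity, an integer; so identities are
unique. Edges join nodes only, and the input is the empty string off the node set, so that two
configurations are equal exactly if they have the same nodes, edges and inputs. -/
@[ext]
structure Config where
  nodes : Finset ℤ
  graph : SimpleGraph ℤ
  input : ℤ → Bits
  mem_of_adj : ∀ u v, graph.Adj u v → u ∈ nodes
  input_of_notMem : ∀ v, v ∉ nodes → input v = []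

/-- `C' ≤ C`: the graph of `C'` is a subgraph (not necessarily induced) of the graph of `C`, and
the input of `C'` is the restriction of the input of `C`. -/
instance : LE Config where
  le C' C := C'.nodes ⊆ C.nodes ∧ C'.graph ≤ C.graph ∧ ∀ v ∈ C'.nodes, C'.input v = C.input v

open Classical in
/-- The configuration on the nodes in `W`, with the edges of `C` between them and with input `x`. -/
noncomputable def Config.induce (C : Config) (W : Finset ℤ) (x : ℤ → Bits) : Config where
  nodes := W
  graph :=
    { Adj := fun u v => C.graph.Adj u v ∧ u ∈ W ∧ v ∈ W
      symm := ⟨fun _ _ h => ⟨h.1.symm, h.2.2, h.2.1⟩⟩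
      loopless := ⟨fun _ h => C.graph.loopless.irrefl _ h.1⟩ }
  input := fun v => if v ∈ W then x v else []
  mem_of_adj := fun _ _ h => h.2.1
  input_of_notMem := fun _ h => if_neg h

open Classical in
/-- The union of two configurations (used for disjoint node sets). -/
noncomputable def Config.union (C D : Config) : Config where
  nodes := C.nodes ∪ D.nodes
  graph := C.graph ⊔ D.graph
  input := fun v => if v ∈ C.nodes then C.input v else D.input v
  mem_of_adj := by
    intro u v h
    rcases h with h | h
    · exact Finset.mem_union_left _ (C.mem_of_adj u v h)
    · exact Finset.mem_union_right _ (D.mem_of_adj u v h)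
  input_of_notMem := by
    intro v h
    rw [Finset.notMem_union] at h
    rw [if_neg h.1, D.input_of_notMem v h.2]

/-- A problem: a collection of triplets `(G, x, y)`, closed under disjoint union. Output vectors
are written as functions on all integers; only their values on the nodes matter. -/
structure Problem where
  Sol : Config → (ℤ → Bits) → Prop
  congr : ∀ C y y', (∀ v ∈ C.nodes, y v = y' v) → Sol C y → Sol C y'
  union : ∀ C D y, Disjoint C.nodes D.nodes → Sol C y → Sol D y → Sol (C.union D) y

/-- A collection of instances of `Pb`, closed under inclusion. -/
structure Family (Pb : Problem) where
  carrier : Set Config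
  isInstance : ∀ C ∈ carrier, ∃ y, Pb.Sol C y
  closed : ∀ C ∈ carrier, ∀ C', C' ≤ C → C' ∈ carrier

/-- A parameter `p` is non-decreasing on the family `F`. -/
def NonDecreasing {Pb : Problem} (F : Family Pb) (p : Config → ℕ) : Prop :=
  ∀ C ∈ F.carrier, ∀ C' ∈ F.carrier, C' ≤ C → p C' ≤ p C

/-! ### Local algorithms -/

/-- The code of a synchronous message-passing algorithm in the LOCAL model, run by every node.
A node starts from its own identity and its input only. Local computation is arbitrary and messages
are bit strings of any length. `send s i` is the message, if any, that a node in state `s` sends to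
its neighbour of identity `i`; `recv s m` is the state after receiving the messages `m`, where `m i`
is the message from the neighbour of identity `i`. A node terminates as soon as its output variable
`output` holds a value. -/
structure LocalAlg (In Out : Type) where
  State : Type
  init : ℤ → In → State
  send : State → ℤ → Option Bits
  recv : State → (ℤ → Option Bits) → State
  output : State → Option Out

namespace LocalAlg

variable {In Out : Type}

open Classical in
/-- The messages that reach node `v` in a round that starts from the global state `s`. Terminated
nodes are silent. -/
noncomputable def inbox (A : LocalAlg In Out) (G : SimpleGraph ℤ) (s : ℤ → A.State) (v : ℤ) :
    ℤ → Option Bits :=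
  fun u => if G.Adj u v ∧ A.output (s u) = none then A.send (s u) v else none

/-- The state of each node after `t` rounds. A terminated node does not change any more. -/
noncomputable def state (A : LocalAlg In Out) (G : SimpleGraph ℤ) (x : ℤ → In) :
    ℕ → ℤ → A.State
  | 0, v => A.init v (x v)
  | t + 1, v =>
    match A.output (A.state G x t v) with
    | some _ => A.state G x t v
    | none => A.recv (A.state G x t v) (A.inbox G (A.state G x t) v)

/-- The output variable of node `v` after `t` rounds (`none` if `v` has not terminated). -/
noncomputable def outputAt (A : LocalAlg In Out) (G : SimpleGraph ℤ) (x : ℤ → In)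
    (t : ℕ) (v : ℤ) : Option Out :=
  A.output (A.state G x t v)

end LocalAlg

/-! ### Randomized local algorithms -/

/-- The private source of random bits of a node. -/
abbrev Tape : Type := ℕ → Bool

/-- One infinite sequence of independent fair bits per node, independent for different nodes. -/
noncomputable def coins : Measure (ℤ → Tape) :=
  Measure.infinitePi fun _ : ℤ => Measure.infinitePi fun _ : ℕ =>
    (PMF.uniformOfFintype Bool).toMeasure

/-- A randomized local algorithm: each node also has access to its own random bits. What a node
has output after a given number of rounds has to be a random variable. -/
structure RandAlg extends LocalAlg (Bits × Tape) Bits where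
  measurableSet_output : ∀ (C : Config) (t : ℕ) (v : ℤ) (y : Bits),
    MeasurableSet {ω : ℤ → Tape |
      toLocalAlg.outputAt C.graph (fun u => (C.input u, ω u)) t v = some y}

namespace RandAlg

/-- The output variable of node `v` after `t` rounds on `C`, with random bits `ω`. -/
noncomputable def out (A : RandAlg) (C : Config) (ω : ℤ → Tape) (t : ℕ) (v : ℤ) : Option Bits :=
  A.toLocalAlg.outputAt C.graph (fun u => (C.input u, ω u)) t v

/-- All nodes have terminated after `t` rounds. -/
def Terminated (A : RandAlg) (C : Config) (ω : ℤ → Tape) (t : ℕ) : Prop :=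
  ∀ v ∈ C.nodes, (A.out C ω t v).isSome

/-- After `t` rounds all nodes have terminated, and the output vector is a solution. -/
def SolvesBy (A : RandAlg) (Pb : Problem) (C : Config) (ω : ℤ → Tape) (t : ℕ) : Prop :=
  A.Terminated C ω t ∧ Pb.Sol C (fun v => (A.out C ω t v).getD [])

/-- The number of rounds until all nodes have terminated (`∞` if that never happens). -/
noncomputable def runTime (A : RandAlg) (C : Config) (ω : ℤ → Tape) : ℝ≥0∞ :=
  ⨅ (t : ℕ) (_ : A.Terminated C ω t), (t : ℝ≥0∞)

/-- The expected running time. -/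
noncomputable def expectedTime (A : RandAlg) (C : Config) : ℝ≥0∞ :=
  ∫⁻ ω, A.runTime C ω ∂coins

/-- `A` is a Las Vegas algorithm for `Pb` and `F`: on every instance, it terminates with a solution
with probability one, and its expected running time is finite. -/
def IsLasVegas (A : RandAlg) (Pb : Problem) (F : Family Pb) : Prop :=
  ∀ C ∈ F.carrier, (∀ᵐ ω ∂coins, ∃ t, A.SolvesBy Pb C ω t) ∧ A.expectedTime C < ∞

end RandAlg

/-- `g` is a collection of good guesses for the parameters `Γ` on `C`. -/
def GoodGuesses {l : ℕ} (Γ : Fin l → Config → ℕ) (C : Config) (g : Fin l → ℕ) : Prop :=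
  ∀ k, Γ k C ≤ g k

/-- `A`, whose code uses a guess for each parameter in `Γ`, is a weak Monte-Carlo algorithm with
guarantee `ρ` for `Pb` and `F` that depends on `Γ`, and `f` bounds its running time: on every
instance and with all good guesses `g`, there is a time `T ≤ f g` by which `A` has output
a solution with probability at least `ρ`. Nothing is required if a guess is not good, or in case of
failure; in particular `A` need not terminate then. -/
def IsWeakMonteCarlo {l : ℕ} (Pb : Problem) (F : Family Pb) (Γ : Fin l → Config → ℕ)
    (A : (Fin l → ℕ) → RandAlg) (ρ : ℝ) (f : (Fin l → ℕ) → ℝ) : Prop :=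
  ∀ C ∈ F.carrier, ∀ g, GoodGuesses Γ C g →
    ∃ T : ℕ, (T : ℝ) ≤ f g ∧ ENNReal.ofReal ρ ≤ coins {ω | (A g).SolvesBy Pb C ω T}

/-! ### Sequence-number functions -/

/-- Moderately-slow functions on the positive integers (the value at `0` plays no role). -/
def ModeratelySlow (s : ℕ → ℕ) : Prop :=
  MonotoneOn s (Set.Ici 1) ∧ ∃ α : ℕ, 0 < α ∧ ∀ i, 2 ≤ i → s (2 * i) ≤ α * s i

/-- `S` is a set-sequence for `f`: for `i ≥ 1`, each vector `y` with `f y ≤ i` is dominated by some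
vector in the finite set `S i`. -/
def IsSetSequence {l : ℕ} (f : (Fin l → ℕ) → ℝ) (S : ℕ → Finset (Fin l → ℕ)) : Prop :=
  ∀ i : ℕ, 1 ≤ i → ∀ y, f y ≤ i → ∃ x ∈ S i, y ≤ x

/-- The set-sequence `S` is bounded, with bounding constant `c`. -/
def IsBoundedBy {l : ℕ} (f : (Fin l → ℕ) → ℝ) (S : ℕ → Finset (Fin l → ℕ)) (c : ℝ) : Prop :=
  ∀ i : ℕ, 1 ≤ i → ∀ x ∈ S i, f x ≤ c * i

/-- `s` is a sequence-number function for `f`. -/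
def IsSequenceNumber {l : ℕ} (f : (Fin l → ℕ) → ℝ) (s : ℕ → ℕ) : Prop :=
  ModeratelySlow s ∧ ∃ S : ℕ → Finset (Fin l → ℕ),
    IsSetSequence f S ∧ (∃ c : ℝ, 0 < c ∧ IsBoundedBy f S c) ∧ ∀ i, 1 ≤ i → (S i).card ≤ s i

/-! ### Pruning algorithms -/

/-- The output of a pruning algorithm at a node: either the node is pruned, or it is kept, with a
possibly new input. -/
inductive Verdict : Type
  | prune : Verdict
  | keep (x' : Bits) : Verdict

/-- The new input of a node (the empty string if it is pruned). -/
def Verdict.newInput : Verdict → Bits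
  | .prune => []
  | .keep x' => x'

/-- The verdict at node `v` after `T` rounds of the deterministic algorithm `P` on the triplet
`(C, y)`, where `y` is a tentative output vector. -/
noncomputable def verdictAt (P : LocalAlg (Bits × Bits) Verdict) (T : ℕ) (C : Config)
    (y : ℤ → Bits) (v : ℤ) : Option Verdict :=
  P.outputAt C.graph (fun u => (C.input u, y u)) T v

open Classical in
/-- The configuration returned by `P`, run for `T` rounds on `(C, y)`: the subgraph induced by the
nodes that are not pruned, with their new inputs. -/
noncomputable def pruneResult (P : LocalAlg (Bits × Bits) Verdict) (T : ℕ) (C : Config)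
    (y : ℤ → Bits) : Config :=
  C.induce (C.nodes.filter fun v => verdictAt P T C y v ≠ some Verdict.prune)
    (fun v => ((verdictAt P T C y v).getD Verdict.prune).newInput)

open Classical in
/-- The combined output vector: `y'` on the nodes of `C'`, and `y` elsewhere. -/
noncomputable def combine (C' : Config) (y y' : ℤ → Bits) : ℤ → Bits :=
  fun v => if v ∈ C'.nodes then y' v else y v

/-- A pruning algorithm for `Pb` and `F`: a uniform deterministic local algorithm with constant
running time `time` that takes triplets `(C, y)` with `C ∈ F` to configurations in `F`, with the
solution detection and gluing properties. -/
structure PruningAlg (Pb : Problem) (F : Family Pb) where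
  alg : LocalAlg (Bits × Bits) Verdict
  time : ℕ
  terminates : ∀ C ∈ F.carrier, ∀ y, ∀ v ∈ C.nodes, (verdictAt alg time C y v).isSome
  result_mem : ∀ C ∈ F.carrier, ∀ y, pruneResult alg time C y ∈ F.carrier
  detection : ∀ C ∈ F.carrier, ∀ y, Pb.Sol C y → (pruneResult alg time C y).nodes = ∅
  gluing : ∀ C ∈ F.carrier, ∀ y y', Pb.Sol (pruneResult alg time C y) y' →
    Pb.Sol C (combine (pruneResult alg time C y) y y')

/-- The pruning algorithm `P` is `Γ`-monotone. -/
def PruningAlg.IsMonotone {Pb : Problem} {F : Family Pb} (P : PruningAlg Pb F) {l : ℕ}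
    (Γ : Fin l → Config → ℕ) : Prop :=
  ∀ k, ∀ C ∈ F.carrier, ∀ y, Γ k (pruneResult P.alg P.time C y) ≤ Γ k C

/-!
A Las Vegas algorithm is obtained by alternating Monte-Carlo runs with pruning. The `i`-th run
executes `A` for `⌊f g⌋` rounds with the `i`-th guess `g` of a fixed schedule and submits the result
to `P`. The pruned nodes adopt their tentative output and fall silent, and the others go on with the
next run on what is left, with their new inputs and with fresh random bits. When nothing is left,
the gluing property shows that the outputs of all runs together are a solution (`solvesBy_altAlg`).

The schedule goes through the scales `2, 4, 8, …`. At scale `i` it contains every guess in `S i`,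
`R` times each, so that scale `i` costs `O(i * s i)` rounds, and `i * s i` grows at most by the
factor `2 * α` from one scale to the next. Let `i*` be the least scale that is at least `f*`. From
`i*` on, `S i` contains a good guess, which remains good since `P` is monotone, so that each scale
leaves something with probability at most `(1 - ρ) ^ R`. As `R` is chosen such that
`(1 - ρ) ^ R * (2 * α) ≤ 1 / 2`, the expected cost of the scales beyond `i*` is a geometric series
dominated by the cost of `i*`, as is the cost of the scales before (`tsum_scale_le`); and `i* * s i*`
is `O(f* * s ⌈f*⌉)` (`exists_scale`).

The random bits of a run are the even positions of the tapes, and the odd positions are left for the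
later runs; both halves are independent and distributed like the coins (`measurePreserving_split`).
So whatever is proved about the alternation is proved by induction on the number of runs: after the
first run it behaves like the alternation that starts with the next run on what is left
(`altLocal_state_len_add`). The local states carry no measurable structure; measurability is
inherited from the outputs of the runs, of which there are countably many on a finite node set
(`measurableSet_altGuess`).
-/

/-! ### Splitting the random bits -/

/-- The random bits of one run: the even positions of every tape. -/
def headTape (r : Tape) : Tape := fun n => r (2 * n)

/-- The random bits left for the later runs: the odd positions of every tape. -/
def tailTape (r : Tape) : Tape := fun n => r (2 * n + 1)

instance : IsProbabilityMeasure coins := by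
  unfold coins; infer_instance

/-- The two halves of the coins are independent, and each is distributed like the coins. -/
theorem measurePreserving_split :
    MeasurePreserving (fun ω : ℤ → Tape => (fun v => headTape (ω v), fun v => tailTape (ω v)))
      coins (coins.prod coins) := by
  let ν : Measure Bool := (PMF.uniformOfFintype Bool).toMeasure
  let Λ : Measure (ℤ × ℕ → Bool) := Measure.infinitePi fun _ => ν
  have hmeas : Measurable
      (fun ω : ℤ → Tape => (fun v => headTape (ω v), fun v => tailTape (ω v))) := by
    unfold headTape tailTape; fun_prop
  refine ⟨hmeas, ?_⟩
  have hc : coins = Λ.map (fun g v n => g (v, n)) :=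
    (Measure.infinitePi_map_curry (fun (_ : ℤ) (_ : ℕ) => ν)).symm
  let e : Bool × (ℤ × ℕ) → ℤ × ℕ := fun p => (p.2.1, 2 * p.2.2 + p.1.toNat)
  have he : Function.Injective e := by
    rintro ⟨b, v, n⟩ ⟨b', v', n'⟩ h
    simp only [e, Prod.mk.injEq] at h
    obtain ⟨rfl, h⟩ := h
    cases b <;> cases b' <;> simp only [Bool.toNat_true, Bool.toNat_false] at h <;>
      first | omega | (congr 2; omega)
  have h1 : Λ.map (fun g p => g (e p)) = Measure.infinitePi fun _ : Bool × (ℤ × ℕ) => ν :=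
    Measure.map_infinitePi_infinitePi_of_inj he
  have h2 : (Measure.infinitePi fun _ : Bool × (ℤ × ℕ) => ν).map (fun g b q => g (b, q))
      = Measure.infinitePi fun _ : Bool => Λ :=
    Measure.infinitePi_map_curry (fun (_ : Bool) (_ : ℤ × ℕ) => ν)
  have h3 : (Measure.infinitePi fun _ : Bool => Λ).map (fun g => (g false, g true))
      = Λ.prod Λ :=
    Measure.infinitePi_map_eval_prod (P := fun _ : Bool => Λ) (by simp)
  conv_rhs => rw [hc]
  rw [Measure.map_prod_map _ _ (by fun_prop) (by fun_prop), ← h3, ← h2, ← h1, hc,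
    Measure.map_map hmeas (by fun_prop), Measure.map_map (by fun_prop) (by fun_prop),
    Measure.map_map (by fun_prop) (by fun_prop), Measure.map_map (by fun_prop) (by fun_prop)]
  rfl

/-! ### Local algorithms see only the nodes of a configuration -/

namespace LocalAlg

variable {In Out : Type} (A : LocalAlg In Out)

/-- The message that a node in state `a` really sends to `u`: terminated nodes are silent. -/
def emit (a : A.State) (u : ℤ) : Option Bits :=
  match A.output a with
  | some _ => none
  | none => A.send a u

/-- The next state of a node in state `a` that receives `m`: terminated nodes do not change. -/
def advance (a : A.State) (m : ℤ → Option Bits) : A.State :=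
  match A.output a with
  | some _ => a
  | none => A.recv a m

open Classical in
theorem inbox_apply (G : SimpleGraph ℤ) (s : ℤ → A.State) (v u : ℤ) :
    A.inbox G s v u = if G.Adj u v then A.emit (s u) v else none := by
  unfold inbox emit
  by_cases h : G.Adj u v
  · rw [if_pos h]
    split <;> rename_i h' <;> split <;> simp_all
  · rw [if_neg (fun h' => h h'.1), if_neg h]

theorem state_succ (G : SimpleGraph ℤ) (x : ℤ → In) (t : ℕ) (v : ℤ) :
    A.state G x (t + 1) v = A.advance (A.state G x t v) (A.inbox G (A.state G x t) v) :=
  rfl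

theorem state_congr (C : Config) {x x' : ℤ → In}
    (h : ∀ v ∈ C.nodes, x v = x' v) (t : ℕ) :
    ∀ v ∈ C.nodes, A.state C.graph x t v = A.state C.graph x' t v := by
  induction t with
  | zero => intro v hv; simp only [state, h v hv]
  | succ t ih =>
    intro v hv
    have hin : A.inbox C.graph (A.state C.graph x t) v
        = A.inbox C.graph (A.state C.graph x' t) v := by
      funext u
      rw [inbox_apply, inbox_apply]
      by_cases hu : C.graph.Adj u v
      · rw [ih u (C.mem_of_adj u v hu)]
      · rw [if_neg hu, if_neg hu]
    rw [state_succ, state_succ, ih v hv, hin]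

theorem outputAt_add (G : SimpleGraph ℤ)
    (x : ℤ → In) {t : ℕ} {v : ℤ} {y : Out} (h : A.outputAt G x t v = some y) (d : ℕ) :
    A.outputAt G x (t + d) v = some y := by
  induction d with
  | zero => exact h
  | succ d ih =>
    have h' := ih
    unfold outputAt at ih h' ⊢
    rw [← add_assoc, state_succ, advance, ih]
    exact h'

end LocalAlg

theorem RandAlg.SolvesBy.mono {A : RandAlg} {Pb : Problem} {C : Config} {ω : ℤ → Tape} {t t' : ℕ}
    (h : A.SolvesBy Pb C ω t) (htt' : t ≤ t') : A.SolvesBy Pb C ω t' := by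
  obtain ⟨d, rfl⟩ := Nat.exists_eq_add_of_le htt'
  have key : ∀ v ∈ C.nodes, A.out C ω (t + d) v = A.out C ω t v := by
    intro v hv
    obtain ⟨y, hy⟩ := Option.isSome_iff_exists.mp (h.1 v hv)
    rw [hy]
    exact A.outputAt_add _ _ hy d
  exact ⟨fun v hv => by rw [key v hv]; exact h.1 v hv,
    Pb.congr _ _ _ (fun v hv => by rw [key v hv]) h.2⟩

theorem verdictAt_congr (P : LocalAlg (Bits × Bits) Verdict) (T : ℕ) (C : Config)
    {y y' : ℤ → Bits} (h : ∀ v ∈ C.nodes, y v = y' v) :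
    ∀ v ∈ C.nodes, verdictAt P T C y v = verdictAt P T C y' v := fun v hv =>
  congrArg P.output (P.state_congr C (fun u hu => by rw [h u hu]) T v hv)

theorem mem_nodes_pruneResult {P : LocalAlg (Bits × Bits) Verdict} {T : ℕ} {C : Config}
    {y : ℤ → Bits} {v : ℤ} : v ∈ (pruneResult P T C y).nodes ↔
      v ∈ C.nodes ∧ verdictAt P T C y v ≠ some Verdict.prune := by
  simp [pruneResult, Config.induce]

theorem adj_pruneResult {P : LocalAlg (Bits × Bits) Verdict} {T : ℕ} {C : Config}
    {y : ℤ → Bits} {u v : ℤ} : (pruneResult P T C y).graph.Adj u v ↔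
      C.graph.Adj u v ∧ u ∈ (pruneResult P T C y).nodes ∧ v ∈ (pruneResult P T C y).nodes :=
  Iff.rfl

theorem input_pruneResult {P : LocalAlg (Bits × Bits) Verdict} {T : ℕ} {C : Config}
    {y : ℤ → Bits} {v : ℤ} (hv : v ∈ (pruneResult P T C y).nodes) :
    (pruneResult P T C y).input v = ((verdictAt P T C y v).getD Verdict.prune).newInput :=
  if_pos hv

theorem pruneResult_congr (P : LocalAlg (Bits × Bits) Verdict) (T : ℕ) (C : Config)
    {y y' : ℤ → Bits} (h : ∀ v ∈ C.nodes, y v = y' v) :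
    pruneResult P T C y = pruneResult P T C y' := by
  have hn : (pruneResult P T C y).nodes = (pruneResult P T C y').nodes := by
    ext v
    rw [mem_nodes_pruneResult, mem_nodes_pruneResult]
    exact and_congr_right fun hv => by rw [verdictAt_congr P T C h v hv]
  refine Config.ext hn ?_ ?_
  · ext u v
    rw [adj_pruneResult, adj_pruneResult, hn]
  · funext v
    by_cases hv : v ∈ (pruneResult P T C y).nodes
    · rw [input_pruneResult hv, input_pruneResult (hn ▸ hv),
        verdictAt_congr P T C h v (mem_nodes_pruneResult.mp hv).1]
    · rw [Config.input_of_notMem _ _ hv, Config.input_of_notMem _ _ (hn ▸ hv)]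

/-! ### Alternating Monte-Carlo runs with the pruning algorithm -/

/-- The local state of the alternation: the algorithm `B i` is run, its output is tested by `P`,
and the nodes that `P` keeps go on with `B (i + 1)`. -/
inductive AltState (B : ℕ → RandAlg) (P : LocalAlg (Bits × Bits) Verdict) : Type
  /-- After `j` rounds of `B i` at node `v` with input `x`; `r` is the unused part of the tape. -/
  | run (i j : ℕ) (v : ℤ) (x : Bits) (r : Tape) (a : (B i).State)
  /-- After `j` rounds of `P` on the tentative output `y` of `B i`. -/
  | test (i j : ℕ) (v : ℤ) (r : Tape) (y : Bits) (p : P.State)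
  /-- The node has been pruned and has adopted the output `y`. -/
  | done (y : Bits)

section Alternation

variable (B : ℕ → RandAlg) (T : ℕ → ℕ) (P : LocalAlg (Bits × Bits) Verdict) (time : ℕ)

/-- The state in which a node starts the `i`-th run. -/
def altInit (i : ℕ) (v : ℤ) (p : Bits × Tape) : AltState B P :=
  .run i 0 v p.1 (tailTape p.2) ((B i).init v (p.1, headTape p.2))

/-- The alternation, started with the `i`-th run. The `i`-th run takes `T i` rounds of `B i`, one
silent round to start `P`, `time` rounds of `P`, and one silent round to act on its verdict. Nodes
without an output after `T i` rounds of `B i` submit the empty string to `P`. -/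
@[reducible] def altLocal (i : ℕ) : LocalAlg (Bits × Tape) Bits where
  State := AltState B P
  init := altInit B P i
  send s u :=
    match s with
    | .run i _ _ _ _ a => (B i).emit a u
    | .test _ _ _ _ _ p => P.emit p u
    | .done _ => none
  recv s m :=
    match s with
    | .run i j v x r a =>
      if j < T i then .run i (j + 1) v x r ((B i).advance a m)
      else .test i 0 v r (((B i).output a).getD []) (P.init v (x, ((B i).output a).getD []))
    | .test i j v r y p =>
      if j < time then .test i (j + 1) v r y (P.advance p m)
      else
        match P.output p with
        | some .prune => .done y
        | some (.keep x') => altInit B P (i + 1) v (x', r)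
        | none => altInit B P (i + 1) v ([], r)
    | .done y => .done y
  output s :=
    match s with
    | .done y => some y
    | _ => none

/-- The number of rounds of the `i`-th run. -/
def altLen (i : ℕ) : ℕ := T i + time + 2

/-- The tentative output of the `i`-th run on `D` with random bits `a`. -/
noncomputable def altGuess (i : ℕ) (D : Config) (a : ℤ → Tape) (v : ℤ) : Bits :=
  ((B i).out D a (T i) v).getD []

/-- What is left of `D` after the `i`-th run with random bits `a`. -/
noncomputable def altStep (i : ℕ) (D : Config) (a : ℤ → Tape) : Config :=
  pruneResult P time D (altGuess B T i D a)

variable {B T P time}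

theorem altLocal_state_run (i : ℕ) (D : Config) (ω : ℤ → Tape) {j : ℕ} (hj : j ≤ T i) (v : ℤ) :
    (altLocal B T P time i).state D.graph (fun u => (D.input u, ω u)) j v =
      .run i j v (D.input v) (tailTape (ω v))
        ((B i).state D.graph (fun u => (D.input u, headTape (ω u))) j v) := by
  induction j generalizing v with
  | zero => rfl
  | succ j ih =>
    have hin : (altLocal B T P time i).inbox D.graph
          ((altLocal B T P time i).state D.graph (fun u => (D.input u, ω u)) j) v
        = (B i).inbox D.graph
          ((B i).state D.graph (fun u => (D.input u, headTape (ω u))) j) v := by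
      funext u
      rw [LocalAlg.inbox_apply, LocalAlg.inbox_apply, ih (by omega)]
      rfl
    rw [LocalAlg.state_succ, hin, ih (by omega), LocalAlg.state_succ]
    exact if_pos (show j < T i by omega)

theorem altLocal_state_test (i : ℕ) (D : Config) (ω : ℤ → Tape) {j : ℕ} (hj : j ≤ time) (v : ℤ) :
    (altLocal B T P time i).state D.graph (fun u => (D.input u, ω u)) (T i + 1 + j) v =
      .test i j v (tailTape (ω v)) (altGuess B T i D (fun u => headTape (ω u)) v)
        (P.state D.graph
          (fun u => (D.input u, altGuess B T i D (fun u => headTape (ω u)) u)) j v) := by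
  induction j generalizing v with
  | zero =>
    rw [add_zero, LocalAlg.state_succ, altLocal_state_run i D ω le_rfl]
    exact if_neg (lt_irrefl _)
  | succ j ih =>
    set y := altGuess B T i D (fun u => headTape (ω u))
    have hin : (altLocal B T P time i).inbox D.graph
          ((altLocal B T P time i).state D.graph (fun u => (D.input u, ω u)) (T i + 1 + j)) v
        = P.inbox D.graph (P.state D.graph (fun u => (D.input u, y u)) j) v := by
      funext u
      rw [LocalAlg.inbox_apply, LocalAlg.inbox_apply, ih (by omega)]
      rfl
    rw [← add_assoc, LocalAlg.state_succ, hin, ih (by omega), LocalAlg.state_succ]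
    exact if_pos (show j < time by omega)

/-- At the end of the `i`-th run, the nodes that are left start the next run on what is left, with
fresh random bits, and the pruned nodes have terminated with their tentative output. -/
theorem altLocal_state_len (i : ℕ) (D : Config) (ω : ℤ → Tape) {v : ℤ} (hv : v ∈ D.nodes) :
    (v ∈ (altStep B T P time i D fun u => headTape (ω u)).nodes →
      (altLocal B T P time i).state D.graph (fun u => (D.input u, ω u)) (altLen T time i) v =
        altInit B P (i + 1) v
          ((altStep B T P time i D fun u => headTape (ω u)).input v, tailTape (ω v))) ∧
    (v ∉ (altStep B T P time i D fun u => headTape (ω u)).nodes →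
      (altLocal B T P time i).state D.graph (fun u => (D.input u, ω u)) (altLen T time i) v =
        .done (altGuess B T i D (fun u => headTape (ω u)) v)) := by
  set y := altGuess B T i D (fun u => headTape (ω u)) with hy
  have hD : altStep B T P time i D (fun u => headTape (ω u)) = pruneResult P time D y := rfl
  have h1 : (altLocal B T P time i).state D.graph (fun u => (D.input u, ω u)) (altLen T time i) v
      = match verdictAt P time D y v with
        | some .prune => .done (y v)
        | some (.keep x') => altInit B P (i + 1) v (x', tailTape (ω v))
        | none => altInit B P (i + 1) v ([], tailTape (ω v)) := by
    have h1 : altLen T time i = (T i + 1 + time) + 1 := by unfold altLen; omega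
    rw [h1, LocalAlg.state_succ, altLocal_state_test i D ω le_rfl]
    exact if_neg (lt_irrefl _)
  rw [h1, hD]
  constructor
  · intro hm
    rw [input_pruneResult hm]
    rw [mem_nodes_pruneResult] at hm
    rcases h : verdictAt P time D y v with _ | _ | x'
    · rfl
    · exact absurd h hm.2
    · rfl
  · intro hm
    have : verdictAt P time D y v = some .prune := by
      by_contra h
      exact hm (mem_nodes_pruneResult.mpr ⟨hv, h⟩)
    rw [this]

/-- After the `i`-th run, the nodes that are left behave exactly as if the alternation had been
started with the next run on the configuration that is left: pruned nodes are silent. -/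
theorem altLocal_state_len_add (i : ℕ) (D : Config) (ω : ℤ → Tape) (t : ℕ) {v : ℤ}
    (hv : v ∈ D.nodes) :
    (v ∈ (altStep B T P time i D fun u => headTape (ω u)).nodes →
      (altLocal B T P time i).state D.graph (fun u => (D.input u, ω u)) (altLen T time i + t) v =
        (altLocal B T P time (i + 1)).state (altStep B T P time i D fun u => headTape (ω u)).graph
          (fun u => ((altStep B T P time i D fun u => headTape (ω u)).input u, tailTape (ω u)))
          t v) ∧
    (v ∉ (altStep B T P time i D fun u => headTape (ω u)).nodes →
      (altLocal B T P time i).state D.graph (fun u => (D.input u, ω u)) (altLen T time i + t) v =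
        .done (altGuess B T i D (fun u => headTape (ω u)) v)) := by
  induction t generalizing v with
  | zero => exact altLocal_state_len i D ω hv
  | succ t ih =>
    constructor
    · intro hm
      have hin : (altLocal B T P time i).inbox D.graph ((altLocal B T P time i).state D.graph
            (fun u => (D.input u, ω u)) (altLen T time i + t)) v
          = (altLocal B T P time (i + 1)).inbox
            (altStep B T P time i D fun u => headTape (ω u)).graph
            ((altLocal B T P time (i + 1)).state
              (altStep B T P time i D fun u => headTape (ω u)).graph
              (fun u => ((altStep B T P time i D fun u => headTape (ω u)).input u,
                tailTape (ω u))) t) v := by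
        funext u
        have hadj : (altStep B T P time i D fun u => headTape (ω u)).graph.Adj u v ↔
            D.graph.Adj u v ∧ u ∈ (altStep B T P time i D fun u => headTape (ω u)).nodes :=
          adj_pruneResult.trans ⟨fun h => ⟨h.1, h.2.1⟩, fun h => ⟨h.1, h.2, hm⟩⟩
        rw [LocalAlg.inbox_apply, LocalAlg.inbox_apply]
        by_cases ha : D.graph.Adj u v
        · rw [if_pos ha]
          by_cases hu : u ∈ (altStep B T P time i D fun u => headTape (ω u)).nodes
          · rw [if_pos (hadj.mpr ⟨ha, hu⟩), (ih (D.mem_of_adj u v ha)).1 hu]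
            rfl
          · rw [if_neg (fun h => hu (hadj.mp h).2), (ih (D.mem_of_adj u v ha)).2 hu]
            rfl
        · rw [if_neg ha, if_neg (fun h => ha (hadj.mp h).1)]
      rw [← add_assoc, LocalAlg.state_succ, (ih hv).1 hm, hin, LocalAlg.state_succ]
      rfl
    · intro hm
      rw [← add_assoc, LocalAlg.state_succ, (ih hv).2 hm]
      rfl

theorem altLocal_outputAt_of_lt (i : ℕ) (D : Config) (ω : ℤ → Tape) {t : ℕ}
    (ht : t < altLen T time i) (v : ℤ) :
    (altLocal B T P time i).outputAt D.graph (fun u => (D.input u, ω u)) t v = none := by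
  unfold LocalAlg.outputAt
  unfold altLen at ht
  rcases Nat.lt_or_ge (T i) t with h | h
  · obtain ⟨j, rfl⟩ := Nat.exists_eq_add_of_le (show T i + 1 ≤ t by omega)
    rw [altLocal_state_test i D ω (by omega)]
  · rw [altLocal_state_run i D ω h]

open Classical in
theorem altLocal_outputAt_len_add (i : ℕ) (D : Config) (ω : ℤ → Tape) (t : ℕ) {v : ℤ}
    (hv : v ∈ D.nodes) :
    (altLocal B T P time i).outputAt D.graph (fun u => (D.input u, ω u)) (altLen T time i + t) v =
      if v ∈ (altStep B T P time i D fun u => headTape (ω u)).nodes then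
        (altLocal B T P time (i + 1)).outputAt
          (altStep B T P time i D fun u => headTape (ω u)).graph
          (fun u => ((altStep B T P time i D fun u => headTape (ω u)).input u, tailTape (ω u))) t v
      else some (altGuess B T i D (fun u => headTape (ω u)) v) := by
  unfold LocalAlg.outputAt
  split_ifs with h
  · rw [(altLocal_state_len_add i D ω t hv).1 h]
  · rw [(altLocal_state_len_add i D ω t hv).2 h]

end Alternation

section Alternation

variable {B : ℕ → RandAlg} {T : ℕ → ℕ} {P : LocalAlg (Bits × Bits) Verdict} {time : ℕ}

/-! ### Measurability -/

theorem RandAlg.measurableSet_getD_out (A : RandAlg) (D : Config) (t : ℕ) (v : ℤ) (b : Bits) :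
    MeasurableSet {ω | (A.out D ω t v).getD [] = b} := by
  have h : {ω | (A.out D ω t v).getD [] = b} =
      {ω | A.out D ω t v = some b} ∪ ({_ω | b = []} ∩ (⋃ b', {ω | A.out D ω t v = some b'})ᶜ) := by
    ext ω
    simp only [Set.mem_ofPred_eq, Set.mem_union, Set.mem_inter_iff, Set.mem_compl_iff,
      Set.mem_iUnion]
    cases A.out D ω t v <;> simp [eq_comm]
  rw [h]
  exact (A.measurableSet_output D t v b).union ((MeasurableSet.const _).inter
    (MeasurableSet.iUnion fun b' => A.measurableSet_output D t v b').compl)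

/-- An event about fresh random bits may be chosen by the tentative output of a run at the finitely
many nodes: as there are countably many such outputs, the result is measurable. -/
theorem measurableSet_altGuess (i : ℕ) (D : Config) (E : (ℤ → Bits) → Set (ℤ → Tape))
    (hE : ∀ y, MeasurableSet (E y))
    (hcongr : ∀ y y', (∀ v ∈ D.nodes, y v = y' v) → E y = E y') :
    MeasurableSet {p : (ℤ → Tape) × (ℤ → Tape) | p.2 ∈ E (altGuess B T i D p.1)} := by
  let ext : (D.nodes → Bits) → ℤ → Bits := fun y v => if h : v ∈ D.nodes then y ⟨v, h⟩ else []
  have hext : ∀ y a, (∀ v : D.nodes, altGuess B T i D a v = y v) →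
      E (altGuess B T i D a) = E (ext y) := fun y a h => hcongr _ _ fun v hv => by
    simp only [ext, dif_pos hv]
    exact h ⟨v, hv⟩
  have h : {p : (ℤ → Tape) × (ℤ → Tape) | p.2 ∈ E (altGuess B T i D p.1)} =
      ⋃ y : D.nodes → Bits, (⋂ v : D.nodes, {a | altGuess B T i D a v.1 = y v}) ×ˢ E (ext y) := by
    ext ⟨a, b⟩
    simp only [Set.mem_ofPred_eq, Set.mem_iUnion, Set.mem_prod, Set.mem_iInter]
    constructor
    · intro hb
      refine ⟨fun v => altGuess B T i D a v, fun v => rfl, ?_⟩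
      rwa [← hext _ a fun v => rfl]
    · rintro ⟨y, hy, hb⟩
      rwa [hext y a hy]
  rw [h]
  exact MeasurableSet.iUnion fun y => (MeasurableSet.iInter fun v : D.nodes =>
    (B i).measurableSet_getD_out D (T i) v.1 (y v)).prod (hE _)

theorem measurableSet_altLocal_output (t i : ℕ) (D : Config) {v : ℤ} (hv : v ∈ D.nodes)
    (y : Bits) :
    MeasurableSet {ω : ℤ → Tape | (altLocal B T P time i).outputAt D.graph
      (fun u => (D.input u, ω u)) t v = some y} := by
  classical
  induction t using Nat.strong_induction_on generalizing i D with
  | _ t ih =>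
    rcases Nat.lt_or_ge t (altLen T time i) with ht | ht
    · simp only [altLocal_outputAt_of_lt i D _ ht, reduceCtorEq, Set.ofPred_false,
        MeasurableSet.empty]
    · obtain ⟨t, rfl⟩ := Nat.exists_eq_add_of_le ht
      simp only [altLocal_outputAt_len_add i D _ t hv]
      refine measurePreserving_split.measurable (measurableSet_altGuess (B := B) (T := T) i D
        (fun z => {b | (if v ∈ (pruneResult P time D z).nodes then
          (altLocal B T P time (i + 1)).outputAt (pruneResult P time D z).graph
            (fun u => ((pruneResult P time D z).input u, b u)) t v
          else some (z v)) = some y}) (fun z => ?_) (fun z z' h => ?_))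
      · by_cases hm : v ∈ (pruneResult P time D z).nodes
        · simp only [if_pos hm]
          exact ih t (by unfold altLen; omega) (i + 1) _ hm
        · simp only [if_neg hm, MeasurableSet.const]
      · rw [pruneResult_congr P time D h, h v hv]

variable (B T P time) in
/-- The alternation as a randomized algorithm. -/
noncomputable def altAlg (i : ℕ) : RandAlg where
  toLocalAlg := altLocal B T P time i
  measurableSet_output := by
    intro C t v y
    -- Adding `v` as an isolated node does not affect its run if it is not a node of `C`.
    exact measurableSet_altLocal_output t i
      { nodes := insert v C.nodes
        graph := C.graph
        input := C.input
        mem_of_adj := fun a b h => Finset.mem_insert_of_mem (C.mem_of_adj a b h)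
        input_of_notMem := fun a h =>
          C.input_of_notMem a fun h' => h (Finset.mem_insert_of_mem h') }
      (Finset.mem_insert_self v _) y

/-! ### What is left after several runs -/

variable (B T P time) in
/-- What is left of `D` after `n` runs that start with the `i`-th. -/
noncomputable def altLeft : ℕ → ℕ → Config → (ℤ → Tape) → Config
  | 0, _, D, _ => D
  | n + 1, i, D, ω =>
    altLeft n (i + 1) (altStep B T P time i D fun v => headTape (ω v)) fun v => tailTape (ω v)

theorem nodes_altStep_subset (i : ℕ) (D : Config) (a : ℤ → Tape) :
    (altStep B T P time i D a).nodes ⊆ D.nodes :=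
  fun _ hv => (mem_nodes_pruneResult.mp hv).1

theorem nodes_altLeft_subset (n i : ℕ) (D : Config) (ω : ℤ → Tape) :
    (altLeft B T P time n i D ω).nodes ⊆ D.nodes := by
  induction n generalizing i D ω with
  | zero => exact subset_rfl
  | succ n ih => exact (ih _ _ _).trans (nodes_altStep_subset _ _ _)

theorem measurableSet_altLeft_nonempty (n i : ℕ) (D : Config) :
    MeasurableSet {ω | (altLeft B T P time n i D ω).nodes.Nonempty} := by
  induction n generalizing i D with
  | zero => exact MeasurableSet.const D.nodes.Nonempty
  | succ n ih =>
    exact measurePreserving_split.measurable (measurableSet_altGuess (B := B) (T := T) i D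
      (fun z => {b | (altLeft B T P time n (i + 1) (pruneResult P time D z) b).nodes.Nonempty})
      (fun z => ih _ _) (fun z z' h => by rw [pruneResult_congr P time D h]))

theorem measurableSet_altStep_nonempty (i : ℕ) (D : Config) :
    MeasurableSet {a | (altStep B T P time i D a).nodes.Nonempty} :=
  (measurable_id.prodMk measurable_id) (measurableSet_altGuess (B := B) (T := T) i D
    (fun z => {_b | (pruneResult P time D z).nodes.Nonempty})
    (fun z => MeasurableSet.const _) (fun z z' h => by rw [pruneResult_congr P time D h]))

/-- If each run leaves something of any configuration in `S` with probability at most `w i`, then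
`n` runs do so with at most the product of these probabilities, as the runs use independent bits. -/
theorem coins_altLeft_nonempty_le {S : Set Config}
    (hS : ∀ D ∈ S, ∀ i a, altStep B T P time i D a ∈ S) {w : ℕ → ℝ≥0∞}
    (hw : ∀ D ∈ S, ∀ i, coins {a | (altStep B T P time i D a).nodes.Nonempty} ≤ w i)
    (n i : ℕ) {D : Config} (hD : D ∈ S) :
    coins {ω | (altLeft B T P time n i D ω).nodes.Nonempty} ≤
      ∏ m ∈ Finset.range n, w (i + m) := by
  induction n generalizing i D with
  | zero => simpa using prob_le_one
  | succ n ih =>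
    set E : Set ((ℤ → Tape) × (ℤ → Tape)) :=
      {p | (altLeft B T P time n (i + 1) (altStep B T P time i D p.1) p.2).nodes.Nonempty}
    have hE : MeasurableSet E := measurableSet_altGuess (B := B) (T := T) i D
      (fun z => {b | (altLeft B T P time n (i + 1) (pruneResult P time D z) b).nodes.Nonempty})
      (fun z => measurableSet_altLeft_nonempty _ _ _)
      (fun z z' h => by rw [pruneResult_congr P time D h])
    have h1 : coins {ω | (altLeft B T P time (n + 1) i D ω).nodes.Nonempty}
        = (coins.prod coins) E := measurePreserving_split.measure_preimage hE.nullMeasurableSet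
    rw [h1, Measure.prod_apply hE, Finset.prod_range_succ', add_zero, mul_comm]
    calc ∫⁻ a, coins (Prod.mk a ⁻¹' E) ∂coins
        ≤ ∫⁻ a, {a | (altStep B T P time i D a).nodes.Nonempty}.indicator
            (fun _ => ∏ m ∈ Finset.range n, w (i + (m + 1))) a ∂coins := by
          refine lintegral_mono fun a => ?_
          by_cases ha : (altStep B T P time i D a).nodes.Nonempty
          · rw [Set.indicator_of_mem (by exact ha)]
            refine (ih (i + 1) (hS D hD i a)).trans_eq (Finset.prod_congr rfl fun m _ => ?_)
            rw [add_assoc, add_comm 1 m]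
          · have : Prod.mk a ⁻¹' E = ∅ := by
              ext b
              simp only [Set.mem_preimage, Set.mem_empty_iff_false, iff_false]
              exact fun h => ha (h.mono (nodes_altLeft_subset _ _ _ _))
            rw [this, measure_empty]
            exact zero_le
      _ = (∏ m ∈ Finset.range n, w (i + (m + 1))) *
            coins {a | (altStep B T P time i D a).nodes.Nonempty} :=
          lintegral_indicator_const (measurableSet_altStep_nonempty i D) _
      _ ≤ _ := by rw [mul_comm]; gcongr; exact hw D hD i

end Alternation

/-! ### Correctness and running time of the alternation -/

section Correctness

variable {Pb : Problem} {F : Family Pb} {B : ℕ → RandAlg} {T : ℕ → ℕ} (P : PruningAlg Pb F)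

theorem solvesBy_altAlg_len_add (i : ℕ) {D : Config} (hD : D ∈ F.carrier) (ω : ℤ → Tape) {t : ℕ}
    (h : (altAlg B T P.alg P.time (i + 1)).SolvesBy Pb
      (altStep B T P.alg P.time i D fun u => headTape (ω u)) (fun u => tailTape (ω u)) t) :
    (altAlg B T P.alg P.time i).SolvesBy Pb D ω (altLen T P.time i + t) := by
  classical
  have hout : ∀ v ∈ D.nodes, (altAlg B T P.alg P.time i).out D ω (altLen T P.time i + t) v =
      if v ∈ (altStep B T P.alg P.time i D fun u => headTape (ω u)).nodes then
        (altAlg B T P.alg P.time (i + 1)).out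
          (altStep B T P.alg P.time i D fun u => headTape (ω u)) (fun u => tailTape (ω u)) t v
      else some (altGuess B T i D (fun u => headTape (ω u)) v) :=
    fun v hv => altLocal_outputAt_len_add i D ω t hv
  constructor
  · intro v hv
    rw [hout v hv]
    split_ifs with hm
    · exact h.1 v hm
    · rfl
  · refine Pb.congr _ _ _ (fun v hv => ?_) (P.gluing D hD _ _ h.2)
    rw [hout v hv]
    unfold combine
    by_cases hm : v ∈ (altStep B T P.alg P.time i D fun u => headTape (ω u)).nodes
    · rw [if_pos hm]
      exact if_pos hm
    · rw [if_neg hm]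
      exact if_neg hm

open Classical in
/-- If nothing is left after `n` runs, the problem has been solved in the time of the runs that
started with something left. -/
theorem solvesBy_altAlg (n i : ℕ) {D : Config} (hD : D ∈ F.carrier) (ω : ℤ → Tape)
    (h : ¬ (altLeft B T P.alg P.time n i D ω).nodes.Nonempty) :
    (altAlg B T P.alg P.time i).SolvesBy Pb D ω (∑ m ∈ Finset.range n,
      if (altLeft B T P.alg P.time m i D ω).nodes.Nonempty then altLen T P.time (i + m) else 0) := by
  induction n generalizing i D ω with
  | zero =>
    have hempty : ∀ v, v ∉ D.nodes := fun v hv => h ⟨v, hv⟩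
    obtain ⟨y, hy⟩ := F.isInstance D hD
    exact ⟨fun v hv => absurd hv (hempty v),
      Pb.congr _ _ _ (fun v hv => absurd hv (hempty v)) hy⟩
  | succ n ih =>
    by_cases hne : D.nodes.Nonempty
    · have := solvesBy_altAlg_len_add P i hD ω
        (ih (i + 1) (P.result_mem D hD _) (fun u => tailTape (ω u)) h)
      rw [Finset.sum_range_succ', add_comm]
      convert this using 3
      · exact if_pos hne
      · rw [add_assoc, add_comm 1]
        rfl
    · have hempty : ∀ v, v ∉ D.nodes := fun v hv => hne ⟨v, hv⟩
      obtain ⟨y, hy⟩ := F.isInstance D hD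
      exact ⟨fun v hv => absurd hv (hempty v),
        Pb.congr _ _ _ (fun v hv => absurd hv (hempty v)) hy⟩

theorem runTime_altAlg_le {D : Config} (hD : D ∈ F.carrier) (ω : ℤ → Tape) :
    (altAlg B T P.alg P.time 0).runTime D ω ≤ ∑' m, {ω |
      (altLeft B T P.alg P.time m 0 D ω).nodes.Nonempty}.indicator
        (fun _ => (altLen T P.time m : ℝ≥0∞)) ω := by
  by_cases h : ∃ n, ¬ (altLeft B T P.alg P.time n 0 D ω).nodes.Nonempty
  · obtain ⟨n, hn⟩ := h
    refine (iInf₂_le _ (solvesBy_altAlg P n 0 hD ω hn).1).trans ?_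
    refine le_trans (le_of_eq ?_) (ENNReal.sum_le_tsum (Finset.range n))
    push_cast
    refine Finset.sum_congr rfl fun m _ => ?_
    simp only [Set.indicator_apply, Set.mem_ofPred_eq, zero_add]
  · push Not at h
    have : ∑' m, {ω | (altLeft B T P.alg P.time m 0 D ω).nodes.Nonempty}.indicator
        (fun _ => (altLen T P.time m : ℝ≥0∞)) ω = ∞ := by
      rw [eq_top_iff, ← ENNReal.tsum_const_eq_top_of_ne_zero (α := ℕ) one_ne_zero]
      refine ENNReal.tsum_le_tsum fun m => ?_
      rw [Set.indicator_of_mem (by exact h m)]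
      exact_mod_cast Nat.succ_le_of_lt (Nat.succ_pos _)
    rw [this]
    exact le_top

theorem expectedTime_altAlg_le {S : Set Config} (hSF : S ⊆ F.carrier)
    (hS : ∀ D ∈ S, ∀ i a, altStep B T P.alg P.time i D a ∈ S) {w : ℕ → ℝ≥0∞}
    (hw : ∀ D ∈ S, ∀ i, coins {a | (altStep B T P.alg P.time i D a).nodes.Nonempty} ≤ w i)
    {D : Config} (hD : D ∈ S) :
    (altAlg B T P.alg P.time 0).expectedTime D ≤
      ∑' n, (altLen T P.time n : ℝ≥0∞) * ∏ m ∈ Finset.range n, w m := by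
  refine (lintegral_mono (runTime_altAlg_le P (hSF hD))).trans ?_
  rw [lintegral_tsum fun m => (measurable_const.indicator
    (measurableSet_altLeft_nonempty m 0 D)).aemeasurable]
  refine ENNReal.tsum_le_tsum fun n => ?_
  rw [lintegral_indicator_const (measurableSet_altLeft_nonempty n 0 D)]
  gcongr
  simpa using coins_altLeft_nonempty_le hS hw n 0 hD

/-- If the bound on the expected running time is finite, then the alternation solves the problem
almost surely: the probability that something is left after `n` runs vanishes as `n` grows. -/
theorem ae_solvesBy_altAlg {S : Set Config} (hSF : S ⊆ F.carrier)
    (hS : ∀ D ∈ S, ∀ i a, altStep B T P.alg P.time i D a ∈ S) {w : ℕ → ℝ≥0∞}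
    (hw : ∀ D ∈ S, ∀ i, coins {a | (altStep B T P.alg P.time i D a).nodes.Nonempty} ≤ w i)
    (hfin : ∑' n, (altLen T P.time n : ℝ≥0∞) * ∏ m ∈ Finset.range n, w m ≠ ∞)
    {D : Config} (hD : D ∈ S) :
    ∀ᵐ ω ∂coins, ∃ t, (altAlg B T P.alg P.time 0).SolvesBy Pb D ω t := by
  have hnull : coins (⋂ n, {ω | (altLeft B T P.alg P.time n 0 D ω).nodes.Nonempty}) = 0 := by
    refine le_antisymm (ge_of_tendsto' (ENNReal.tendsto_atTop_zero_of_tsum_ne_top hfin)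
      fun n => ?_) zero_le
    refine (measure_mono (Set.iInter_subset _ n)).trans
      ((coins_altLeft_nonempty_le hS hw n 0 hD).trans ?_)
    simp only [zero_add]
    exact le_mul_of_one_le_left' (by exact_mod_cast Nat.succ_le_of_lt (Nat.succ_pos _))
  filter_upwards [measure_eq_zero_iff_ae_notMem.mp hnull] with ω hω
  simp only [Set.mem_iInter, Set.mem_ofPred_eq, not_forall] at hω
  obtain ⟨n, hn⟩ := hω
  exact ⟨_, solvesBy_altAlg P n 0 (hSF hD) ω hn⟩

end Correctness

/-! ### Concatenating finite lists -/

/-- A sequence of nonempty lists can be concatenated to one infinite sequence. -/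
theorem exists_concat {β : Type*} (L : ℕ → List β) (hL : ∀ j, L j ≠ []) :
    ∃ g : ℕ → β, ∀ j, (List.range (L j).length).map
      (fun i => g (∑ k ∈ Finset.range j, (L k).length + i)) = L j := by
  let N : ℕ → ℕ := fun j => ∑ k ∈ Finset.range j, (L k).length
  have hN : StrictMono N := strictMono_nat_of_lt_succ fun j => by
    simp only [N, Finset.sum_range_succ]
    exact Nat.lt_add_of_pos_right (List.length_pos_iff.mpr (hL j))
  let b : β := (L 0).head (hL 0)
  refine ⟨fun n => (L (Nat.findGreatest (fun j => N j ≤ n) n)).getD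
    (n - N (Nat.findGreatest (fun j => N j ≤ n) n)) b, fun j => ?_⟩
  refine List.ext_getElem (by simp) fun i hi hi' => ?_
  have hj : Nat.findGreatest (fun k => N k ≤ N j + i) (N j + i) = j := by
    rw [Nat.findGreatest_eq_iff]
    refine ⟨(hN.le_apply).trans (Nat.le_add_right _ _), fun _ => Nat.le_add_right _ _,
      fun k hk _ hk' => ?_⟩
    have h1 : N (j + 1) ≤ N k := hN.monotone hk
    have h2 : N (j + 1) = N j + (L j).length := Finset.sum_range_succ _ _
    omega
  rw [List.getElem_map, List.getElem_range]
  change (L (Nat.findGreatest (fun k => N k ≤ N j + i) (N j + i))).getD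
    (N j + i - N (Nat.findGreatest (fun k => N k ≤ N j + i) (N j + i))) b = _
  rw [hj, Nat.add_sub_cancel_left, List.getD_eq_getElem]

/-- Costs weighted by the product of all earlier factors `w ≤ 1`: such a sum over a concatenation of
lists is at most the sum taken list by list. -/
theorem tsum_concat_le {β : Type*} {L : ℕ → List β} (hL : ∀ j, L j ≠ []) {g : ℕ → β}
    (hg : ∀ j, (List.range (L j).length).map
      (fun i => g (∑ k ∈ Finset.range j, (L k).length + i)) = L j)
    (a w : β → ℝ≥0∞) (hw : ∀ x, w x ≤ 1) :
    ∑' n, a (g n) * ∏ m ∈ Finset.range n, w (g m) ≤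
      ∑' j, ((L j).map a).sum * ∏ i ∈ Finset.range j, ((L i).map w).prod := by
  let N : ℕ → ℕ := fun j => ∑ k ∈ Finset.range j, (L k).length
  have hN1 : ∀ j, N (j + 1) = N j + (L j).length := fun j => Finset.sum_range_succ _ _
  have hN : StrictMono N := strictMono_nat_of_lt_succ fun j => by
    rw [hN1]
    exact Nat.lt_add_of_pos_right (List.length_pos_iff.mpr (hL j))
  have hsum : ∀ j, ∑ i ∈ Finset.range (L j).length, a (g (N j + i)) = ((L j).map a).sum := by
    intro j
    conv_rhs => rw [← hg j, List.map_map]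
    rfl
  have hprod : ∀ j, ∏ m ∈ Finset.range (N j), w (g m) =
      ∏ i ∈ Finset.range j, ((L i).map w).prod := by
    intro j
    induction j with
    | zero => rfl
    | succ j ih =>
      rw [hN1, Finset.prod_range_add, ih, Finset.prod_range_succ]
      congr 1
      conv_rhs => rw [← hg j, List.map_map]
      rfl
  rw [ENNReal.tsum_eq_iSup_nat' hN.tendsto_atTop]
  refine iSup_le fun J => le_trans ?_ (ENNReal.sum_le_tsum (Finset.range J))
  induction J with
  | zero => exact zero_le
  | succ J ih =>
    rw [hN1, Finset.sum_range_add, Finset.sum_range_succ]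
    refine add_le_add ih ?_
    rw [← hsum, ← hprod, Finset.sum_mul]
    refine Finset.sum_le_sum fun i _ => ?_
    refine mul_le_mul_right ?_ _
    rw [Finset.prod_range_add]
    exact mul_le_of_le_one_right' (Finset.prod_le_one' fun m _ => hw _)

theorem List.Sublist.prod_map_le_prod_map {β : Type*} {w : β → ℝ≥0∞} (hw : ∀ x, w x ≤ 1)
    {l₁ l₂ : List β} (h : l₁.Sublist l₂) : (l₂.map w).prod ≤ (l₁.map w).prod := by
  induction h with
  | slnil => exact le_rfl
  | cons x _ ih =>
    rw [List.map_cons, List.prod_cons]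
    exact (mul_le_of_le_one_left' (hw x)).trans ih
  | cons_cons x _ ih =>
    rw [List.map_cons, List.prod_cons, List.map_cons, List.prod_cons]
    gcongr

/-! ### The geometric series over the scales -/

/-- If the factors `q j` are at most `δ` from scale `j₀` on, and `δ` outweighs the growth of the
costs from one scale to the next, then the cost of scale `j₀` dominates the weighted sum. -/
theorem tsum_scale_le {s : ℕ → ℕ} (hmono : MonotoneOn s (Set.Ici 1)) {α : ℕ}
    (hα : ∀ i, 2 ≤ i → s (2 * i) ≤ α * s i) {δ : ℝ≥0∞} (hδ : δ * (2 * α) ≤ 2⁻¹)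
    {q : ℕ → ℝ≥0∞} (hq1 : ∀ j, q j ≤ 1) {j₀ : ℕ} (hq : ∀ j, j₀ ≤ j → q j ≤ δ) :
    ∑' j, ((2 ^ (j + 1) * s (2 ^ (j + 1)) : ℕ) : ℝ≥0∞) * ∏ i ∈ Finset.range j, q i ≤
      ((3 * (2 ^ (j₀ + 1) * s (2 ^ (j₀ + 1))) : ℕ) : ℝ≥0∞) := by
  set M : ℕ := 2 ^ (j₀ + 1) * s (2 ^ (j₀ + 1)) with hM
  have hprod1 : ∀ j, ∏ i ∈ Finset.range j, q i ≤ 1 := fun j =>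
    Finset.prod_le_one' fun i _ => hq1 i
  have hlow : ∑ j ∈ Finset.range j₀, ((2 ^ (j + 1) * s (2 ^ (j + 1)) : ℕ) : ℝ≥0∞) *
      ∏ i ∈ Finset.range j, q i ≤ (M : ℕ) := by
    calc _ ≤ ∑ j ∈ Finset.range j₀, ((2 ^ (j + 1) * s (2 ^ (j₀ + 1)) : ℕ) : ℝ≥0∞) := by
          refine Finset.sum_le_sum fun j hj => ?_
          refine (mul_le_of_le_one_right' (hprod1 j)).trans ?_
          gcongr
          refine hmono (Set.mem_Ici.mpr Nat.one_le_two_pow) (Set.mem_Ici.mpr Nat.one_le_two_pow) ?_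
          exact Nat.pow_le_pow_right two_pos (by simp at hj; omega)
      _ ≤ (M : ℕ) := by
          rw [← Nat.cast_sum, ← Finset.sum_mul]
          gcongr
          rw [hM]
          gcongr
          have : ∀ n, ∑ j ∈ Finset.range n, 2 ^ (j + 1) ≤ 2 ^ (n + 1) := by
            intro n
            induction n with
            | zero => simp
            | succ n ih => rw [Finset.sum_range_succ, pow_succ 2 (n + 1)]; omega
          exact this j₀
  have hgrow : ∀ d, 2 ^ (d + j₀ + 1) * s (2 ^ (d + j₀ + 1)) ≤ M * (2 * α) ^ d := by
    intro d
    induction d with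
    | zero => simp [hM]
    | succ d ih =>
      have h1 : s (2 ^ (d + 1 + j₀ + 1)) ≤ α * s (2 ^ (d + j₀ + 1)) := by
        rw [show 2 ^ (d + 1 + j₀ + 1) = 2 * 2 ^ (d + j₀ + 1) by ring]
        refine hα _ ?_
        calc 2 = 2 ^ 1 := rfl
          _ ≤ _ := Nat.pow_le_pow_right two_pos (by omega)
      calc 2 ^ (d + 1 + j₀ + 1) * s (2 ^ (d + 1 + j₀ + 1))
          ≤ 2 ^ (d + 1 + j₀ + 1) * (α * s (2 ^ (d + j₀ + 1))) := by gcongr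
        _ = (2 ^ (d + j₀ + 1) * s (2 ^ (d + j₀ + 1))) * (2 * α) := by ring
        _ ≤ M * (2 * α) ^ d * (2 * α) := by gcongr
        _ = _ := by ring
  have hdecay : ∀ d, ∏ i ∈ Finset.range (d + j₀), q i ≤ δ ^ d := by
    intro d
    induction d with
    | zero => simpa using hprod1 j₀
    | succ d ih =>
      rw [show d + 1 + j₀ = d + j₀ + 1 by ring, Finset.prod_range_succ, pow_succ]
      gcongr
      exact hq _ (by omega)
  have hhigh : ∑' d, ((2 ^ (d + j₀ + 1) * s (2 ^ (d + j₀ + 1)) : ℕ) : ℝ≥0∞) *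
      ∏ i ∈ Finset.range (d + j₀), q i ≤ 2 * (M : ℕ) := by
    calc _ ≤ ∑' d, (M : ℝ≥0∞) * 2⁻¹ ^ d := by
          refine ENNReal.tsum_le_tsum fun d => ?_
          calc _ ≤ ((M * (2 * α) ^ d : ℕ) : ℝ≥0∞) * δ ^ d := by
                exact mul_le_mul' (by exact_mod_cast hgrow d) (hdecay d)
            _ = M * (δ * (2 * α)) ^ d := by push_cast; ring
            _ ≤ _ := by gcongr
      _ = _ := by
          rw [ENNReal.tsum_mul_left, ENNReal.tsum_geometric, ENNReal.one_sub_inv_two, inv_inv,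
            mul_comm]
  rw [← Summable.sum_add_tsum_nat_add' (k := j₀) ENNReal.summable]
  refine (add_le_add hlow hhigh).trans_eq ?_
  push_cast
  ring

/-- For a real `x ≥ ε > 0`, some power `2 ^ (j + 1) ≥ x` is comparable with `x`, and so are the
values of a moderately slow function. -/
theorem exists_scale {s : ℕ → ℕ} (hmono : MonotoneOn s (Set.Ici 1)) {α : ℕ}
    (hα : ∀ i, 2 ≤ i → s (2 * i) ≤ α * s i) (hs : ∀ i, 1 ≤ s i) {ε : ℝ} (hε : 0 < ε) {x : ℝ}
    (hx : ε ≤ x) : ∃ j : ℕ, x ≤ ((2 ^ (j + 1) : ℕ) : ℝ) ∧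
      ((2 ^ (j + 1) * s (2 ^ (j + 1)) : ℕ) : ℝ) ≤
        (4 * α + 2 * s 2 / ε) * (x * s ⌈x⌉₊) := by
  have hx0 : 0 < x := hε.trans_le hx
  have hs1 : (1 : ℝ) ≤ s ⌈x⌉₊ := by exact_mod_cast hs _
  rcases Nat.lt_or_ge 1 ⌈x⌉₊ with hm | hm
  · set m := ⌈x⌉₊
    have hpos := Nat.clog_pos one_lt_two hm
    refine ⟨Nat.clog 2 m - 1, ?_⟩
    rw [Nat.sub_add_cancel hpos]
    have h1 : m ≤ 2 ^ Nat.clog 2 m := Nat.le_pow_clog one_lt_two m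
    have h2 : 2 ^ Nat.clog 2 m ≤ 2 * m := by
      have := Nat.pow_pred_clog_lt_self one_lt_two hm
      calc 2 ^ Nat.clog 2 m = 2 ^ (Nat.clog 2 m).pred * 2 := by
            rw [← pow_succ, Nat.pred_eq_sub_one, Nat.sub_add_cancel hpos]
        _ ≤ 2 * m := by omega
    have h3 : s (2 ^ Nat.clog 2 m) ≤ α * s m :=
      (hmono (Set.mem_Ici.mpr Nat.one_le_two_pow) (Set.mem_Ici.mpr (by omega)) h2).trans (hα m hm)
    have h4 : (m : ℝ) ≤ 2 * x := by
      have h5 : (m : ℝ) < x + 1 := Nat.ceil_lt_add_one hx0.le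
      have h6 : (2 : ℝ) ≤ m := by exact_mod_cast hm
      linarith
    refine ⟨(Nat.le_ceil x).trans (by exact_mod_cast h1), ?_⟩
    calc ((2 ^ Nat.clog 2 m * s (2 ^ Nat.clog 2 m) : ℕ) : ℝ)
        ≤ ((2 * m * (α * s m) : ℕ) : ℝ) := by gcongr
      _ = 2 * α * s m * m := by push_cast; ring
      _ ≤ 2 * α * s m * (2 * x) := by gcongr
      _ = 4 * α * (x * s m) := by ring
      _ ≤ _ := by
          gcongr
          have : 0 ≤ 2 * (s 2 : ℝ) / ε := by positivity
          linarith
  · refine ⟨0, ?_, ?_⟩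
    · have : (⌈x⌉₊ : ℝ) ≤ 1 := by exact_mod_cast hm
      have := Nat.le_ceil x
      norm_num
      linarith
    · calc ((2 ^ (0 + 1) * s (2 ^ (0 + 1)) : ℕ) : ℝ) = 2 * s 2 / ε * (ε * 1) := by
            push_cast
            field_simp
        _ ≤ 2 * s 2 / ε * (x * s ⌈x⌉₊) := by gcongr
        _ ≤ _ := by
            gcongr
            have : (0 : ℝ) ≤ 4 * α := by positivity
            linarith

/-! ### The schedule of guesses -/

/-- A run with good guesses leaves something with probability at most `1 - ρ`: by solution
detection, a correct output leaves nothing. -/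
theorem coins_altStep_nonempty_le {Pb : Problem} {F : Family Pb} {l : ℕ}
    {Γ : Fin l → Config → ℕ} {f : (Fin l → ℕ) → ℝ} {A : (Fin l → ℕ) → RandAlg} {ρ : ℝ}
    (hA : IsWeakMonteCarlo Pb F Γ A ρ f) (P : PruningAlg Pb F) (γ : ℕ → Fin l → ℕ) (i : ℕ)
    {D : Config} (hD : D ∈ F.carrier) (hγ : GoodGuesses Γ D (γ i)) :
    coins {a | (altStep (fun n => A (γ n)) (fun n => ⌊f (γ n)⌋₊) P.alg P.time i D a).nodes.Nonempty}
      ≤ 1 - ENNReal.ofReal ρ := by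
  obtain ⟨t, ht, hρ⟩ := hA D hD (γ i) hγ
  set E := {a | (altStep (fun n => A (γ n)) (fun n => ⌊f (γ n)⌋₊) P.alg P.time i D a).nodes.Nonempty}
  have hE : MeasurableSet E := measurableSet_altStep_nonempty i D
  rw [← compl_compl E, prob_compl_eq_one_sub hE.compl]
  refine tsub_le_tsub_left (hρ.trans (measure_mono fun a ha => ?_)) 1
  have ha' : (A (γ i)).SolvesBy Pb D a ⌊f (γ i)⌋₊ := RandAlg.SolvesBy.mono ha (Nat.le_floor ht)
  have := P.detection D hD _ ha'.2
  exact fun hne => Finset.nonempty_iff_ne_empty.mp hne this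

theorem ModeratelySlow.max_one {s : ℕ → ℕ} (hs : ModeratelySlow s) :
    ModeratelySlow fun i => max (s i) 1 := by
  obtain ⟨hmono, α, hα0, hα⟩ := hs
  refine ⟨fun i hi j hj hij => max_le_max (hmono hi hj hij) le_rfl, α, hα0, fun i hi => ?_⟩
  refine max_le ((hα i hi).trans (Nat.mul_le_mul_left _ (le_max_left _ _))) ?_
  exact Nat.one_le_iff_ne_zero.mpr (by positivity)

theorem theorem2 (Pb : Problem) (F : Family Pb) (l : ℕ)
    (Γ : Fin l → Config → ℕ) (hΓ : ∀ k, NonDecreasing F (Γ k))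
    (f : (Fin l → ℕ) → ℝ) (hf_pos : ∀ g, 0 < f g) (hf_mono : Monotone f)
    (A : (Fin l → ℕ) → RandAlg) (ρ : ℝ) (hρ : ρ ∈ Set.Ioc (0 : ℝ) 1)
    (hA : IsWeakMonteCarlo Pb F Γ A ρ f)
    (s : ℕ → ℕ) (hs : IsSequenceNumber f s)
    (P : PruningAlg Pb F) (hP : P.IsMonotone Γ) :
    ∃ τ : RandAlg, τ.IsLasVegas Pb F ∧
      ∃ K : ℝ, 0 < K ∧ ∀ C ∈ F.carrier,
        τ.expectedTime C ≤
          ENNReal.ofReal (K * (f (fun k => Γ k C) * (s ⌈f (fun k => Γ k C)⌉₊ : ℝ))) := by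
  classical
  obtain ⟨hslow, S, hS, ⟨c, hc0, hc⟩, hcard⟩ := hs
  -- A scale with `s i = 0` has no guesses but `0`, and is charged as if `s i` were `1`.
  let σ : ℕ → ℕ := fun i => max (s i) 1
  have hσ1 : ∀ i, 1 ≤ σ i := fun i => le_max_right _ _
  obtain ⟨hσmono, α, hα0, hα⟩ : ModeratelySlow σ := hslow.max_one
  let r : ℝ≥0∞ := 1 - ENNReal.ofReal ρ
  have hr1 : r ≤ 1 := tsub_le_self
  have hr : r < 1 := ENNReal.sub_lt_self ENNReal.one_ne_top one_ne_zero
    (ENNReal.ofReal_pos.mpr hρ.1).ne'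
  have h2α : (2 * α : ℝ≥0∞) ≠ 0 := by positivity
  have h2α' : (2 * α : ℝ≥0∞) ≠ ∞ := by finiteness
  -- The number of repetitions that outweighs the growth of the costs between scales.
  obtain ⟨R, hR⟩ : ∃ R : ℕ, r ^ R * (2 * α) ≤ 2⁻¹ := by
    have hpos : (0 : ℝ≥0∞) < 2⁻¹ * (2 * α : ℝ≥0∞)⁻¹ := by
      refine pos_iff_ne_zero.mpr (mul_ne_zero (by simp) (ENNReal.inv_ne_zero.mpr h2α'))
    obtain ⟨R, hR⟩ := ((ENNReal.tendsto_pow_atTop_nhds_zero_of_lt_one hr).eventually_lt_const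
      hpos).exists
    refine ⟨R, (mul_le_mul_left hR.le _).trans_eq ?_⟩
    rw [mul_assoc, ENNReal.inv_mul_cancel h2α h2α', mul_one]
  -- The guess `0` only serves to make the lists nonempty.
  let L : ℕ → List (Fin l → ℕ) := fun j =>
    0 :: (S (2 ^ (j + 1))).toList.flatMap fun x => List.replicate R x
  have hL : ∀ j, L j ≠ [] := fun j => List.cons_ne_nil _ _
  obtain ⟨γ, hγ⟩ := exists_concat L hL
  let a : (Fin l → ℕ) → ℝ≥0∞ := fun g => ((⌊f g⌋₊ + P.time + 2 : ℕ) : ℝ≥0∞)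
  let b : ℕ := ⌈c⌉₊ + P.time + 2
  let e : ℕ := ⌊f 0⌋₊ + P.time + 2
  let N : ℕ := e + R * b
  have hcost : ∀ j, ((L j).map a).sum ≤
      (N : ℝ≥0∞) * ((2 ^ (j + 1) * σ (2 ^ (j + 1)) : ℕ) : ℝ≥0∞) := by
    intro j
    have hx : ∀ x ∈ S (2 ^ (j + 1)), a x ≤ ((b * 2 ^ (j + 1) : ℕ) : ℝ≥0∞) := by
      intro x hx
      have h1 : f x ≤ c * (2 ^ (j + 1) : ℕ) := hc _ Nat.one_le_two_pow x hx
      have h2 : ⌊f x⌋₊ ≤ ⌈c⌉₊ * 2 ^ (j + 1) := by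
        refine Nat.floor_le_of_le (h1.trans ?_)
        push_cast
        gcongr
        exact Nat.le_ceil c
      have h3 : 1 ≤ 2 ^ (j + 1) := Nat.one_le_two_pow
      have h4 : ⌊f x⌋₊ + P.time + 2 ≤ b * 2 ^ (j + 1) := by
        calc _ ≤ ⌈c⌉₊ * 2 ^ (j + 1) + (P.time + 2) * 2 ^ (j + 1) := by nlinarith
          _ = _ := by ring
      exact Nat.cast_le.mpr h4
    have hflat : (((S (2 ^ (j + 1))).toList.flatMap fun x => List.replicate R x).map a).sum =
        ∑ x ∈ S (2 ^ (j + 1)), R * a x := by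
      rw [← Finset.sum_map_toList]
      induction (S (2 ^ (j + 1))).toList with
      | nil => rfl
      | cons x t ih => simp [ih]
    calc ((L j).map a).sum = (e : ℝ≥0∞) + ∑ x ∈ S (2 ^ (j + 1)), R * a x := by
          rw [← hflat]; rfl
      _ ≤ (e : ℝ≥0∞) + ∑ x ∈ S (2 ^ (j + 1)), R * ((b * 2 ^ (j + 1) : ℕ) : ℝ≥0∞) := by
          gcongr with x hx'
          exact hx x hx'
      _ = ((e + (S (2 ^ (j + 1))).card * (R * (b * 2 ^ (j + 1))) : ℕ) : ℝ≥0∞) := by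
          rw [Finset.sum_const, nsmul_eq_mul]; push_cast; ring
      _ ≤ ((N * (2 ^ (j + 1) * σ (2 ^ (j + 1))) : ℕ) : ℝ≥0∞) := by
          refine Nat.cast_le.mpr ?_
          have h1 : (S (2 ^ (j + 1))).card ≤ σ (2 ^ (j + 1)) :=
            (hcard _ Nat.one_le_two_pow).trans (le_max_left _ _)
          have h2 : 1 ≤ 2 ^ (j + 1) * σ (2 ^ (j + 1)) := Nat.mul_pos Nat.one_le_two_pow (hσ1 _)
          calc _ ≤ e * (2 ^ (j + 1) * σ (2 ^ (j + 1))) +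
                σ (2 ^ (j + 1)) * (R * (b * 2 ^ (j + 1))) :=
                add_le_add (Nat.le_mul_of_pos_right _ h2) (Nat.mul_le_mul_right _ h1)
            _ = _ := by simp only [N]; ring
      _ = _ := by push_cast; ring
  let B : ℕ → RandAlg := fun n => A (γ n)
  let T : ℕ → ℕ := fun n => ⌊f (γ n)⌋₊
  let K : ℝ := 3 * N * (4 * α + 2 * σ 2 / f 0)
  have hK : 0 < K := by
    have : 0 < N := by simp only [N, e]; omega
    have := hf_pos 0
    positivity
  have key : ∀ C ∈ F.carrier,
      (∀ᵐ ω ∂coins, ∃ t, (altAlg B T P.alg P.time 0).SolvesBy Pb C ω t) ∧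
      (altAlg B T P.alg P.time 0).expectedTime C ≤
        ENNReal.ofReal (K * (f (fun k => Γ k C) * (s ⌈f (fun k => Γ k C)⌉₊ : ℝ))) := by
    intro C hC
    set p : Fin l → ℕ := fun k => Γ k C with hp
    let U : Set Config := {D | D ∈ F.carrier ∧ ∀ k, Γ k D ≤ Γ k C}
    have hCU : C ∈ U := ⟨hC, fun k => le_rfl⟩
    have hUF : U ⊆ F.carrier := fun D hD => hD.1
    have hU : ∀ D ∈ U, ∀ i ω, altStep B T P.alg P.time i D ω ∈ U := fun D hD i ω =>
      ⟨P.result_mem D hD.1 _, fun k => (hP k D hD.1 _).trans (hD.2 k)⟩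
    let w : (Fin l → ℕ) → ℝ≥0∞ := fun g => if GoodGuesses Γ C g then r else 1
    have hw1 : ∀ g, w g ≤ 1 := fun g => by
      simp only [w]; split_ifs; exacts [hr1, le_rfl]
    have hw : ∀ D ∈ U, ∀ i,
        coins {ω | (altStep B T P.alg P.time i D ω).nodes.Nonempty} ≤ w (γ i) := by
      intro D hD i
      by_cases hg : GoodGuesses Γ C (γ i)
      · simp only [w, if_pos hg]
        exact coins_altStep_nonempty_le hA P γ i hD.1 fun k => (hD.2 k).trans (hg k)
      · simp only [w, if_neg hg]
        exact prob_le_one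
    obtain ⟨j₀, hj₀, hscale⟩ := exists_scale hσmono hα hσ1 (hf_pos 0)
      (hf_mono (zero_le : (0 : Fin l → ℕ) ≤ p))
    -- From scale `j₀` on, every list contains `R` copies of a good guess.
    have hq : ∀ j, j₀ ≤ j → ((L j).map w).prod ≤ r ^ R := by
      intro j hj
      have h1 : f p ≤ ((2 ^ (j + 1) : ℕ) : ℝ) := hj₀.trans
        (by exact_mod_cast Nat.pow_le_pow_right two_pos (by omega))
      obtain ⟨x, hx, hpx⟩ := hS _ Nat.one_le_two_pow p h1
      have hsub : (List.replicate R x).Sublist (L j) := by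
        refine List.Sublist.cons _ ?_
        rw [List.flatMap_def]
        exact List.sublist_flatten_of_mem (List.mem_map.mpr ⟨x, Finset.mem_toList.mpr hx, rfl⟩)
      refine (hsub.prod_map_le_prod_map hw1).trans_eq ?_
      simp only [List.map_replicate, List.prod_replicate, w]
      rw [if_pos (show GoodGuesses Γ C x from fun k => hpx k)]
    have hq1 : ∀ j, ((L j).map w).prod ≤ 1 := fun j =>
      (List.nil_sublist (L j)).prod_map_le_prod_map hw1
    have hsum : ∑' n, (altLen T P.time n : ℝ≥0∞) * ∏ m ∈ Finset.range n, w (γ m) ≤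
        ((N * (3 * (2 ^ (j₀ + 1) * σ (2 ^ (j₀ + 1)))) : ℕ) : ℝ≥0∞) := by
      refine (tsum_concat_le hL hγ a w hw1).trans ?_
      calc _ ≤ ∑' j, (N : ℝ≥0∞) * (((2 ^ (j + 1) * σ (2 ^ (j + 1)) : ℕ) : ℝ≥0∞) *
              ∏ i ∈ Finset.range j, ((L i).map w).prod) := by
            refine ENNReal.tsum_le_tsum fun j => ?_
            rw [← mul_assoc]
            exact mul_le_mul_left (hcost j) _
        _ ≤ (N : ℝ≥0∞) * ((3 * (2 ^ (j₀ + 1) * σ (2 ^ (j₀ + 1))) : ℕ) : ℝ≥0∞) := by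
            rw [ENNReal.tsum_mul_left]
            gcongr
            exact tsum_scale_le hσmono hα hR hq1 hq
        _ = _ := by push_cast; ring
    refine ⟨ae_solvesBy_altAlg P hUF hU hw (ne_top_of_le_ne_top (ENNReal.natCast_ne_top _) hsum)
      hCU, ((expectedTime_altAlg_le P hUF hU hw hCU).trans hsum).trans ?_⟩
    -- Some element of `S ⌈f p⌉` dominates `p`, so that `s ⌈f p⌉` is positive.
    have hσs : σ ⌈f p⌉₊ = s ⌈f p⌉₊ := by
      have hm : 1 ≤ ⌈f p⌉₊ := Nat.ceil_pos.mpr (hf_pos p)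
      obtain ⟨x, hx, -⟩ := hS _ hm p (Nat.le_ceil _)
      exact max_eq_left ((Finset.card_pos.mpr ⟨x, hx⟩).trans_le (hcard _ hm))
    rw [hσs] at hscale
    rw [← ENNReal.ofReal_natCast]
    refine ENNReal.ofReal_le_ofReal ?_
    calc ((N * (3 * (2 ^ (j₀ + 1) * σ (2 ^ (j₀ + 1)))) : ℕ) : ℝ)
        = 3 * N * ((2 ^ (j₀ + 1) * σ (2 ^ (j₀ + 1)) : ℕ) : ℝ) := by push_cast; ring
      _ ≤ 3 * N * ((4 * α + 2 * σ 2 / f 0) * (f p * s ⌈f p⌉₊)) := by gcongr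
      _ = K * (f p * s ⌈f p⌉₊) := by ring
  exact ⟨altAlg B T P.alg P.time 0,
    fun C hC => ⟨(key C hC).1, (key C hC).2.trans_lt ENNReal.ofReal_lt_top⟩,
    K, hK, fun C hC => (key C hC).2⟩
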